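/- Let $n\le 3$ be a natural number and regard $M_n(\mathbb{C})$ as a Frobenius algebra in the category of complex vector spaces via the bilinear form $(X,Y)\mapsto \operatorname{Tr}(XY)$; thus its counit is $\epsilon=\operatorname{Tr}$ and its comultiplication is $\Delta(X)=\sum_{i,j} (XE_{i,j})\otimes E_{j,i}$, where $E_{i,j}$ are the elementary matrices. For linear maps $S,T: M_n(\mathbb{C})\to M_n(\mathbb{C})$, the dual of $T$ is $T^*(X)=\sum_{i,j}\operatorname{Tr}(X\,T(E_{i,j}))\,E_{j,i}$, and the convolution product is $(S*T)(X)=\sum_{i,j} S(XE_{i,j})\,T(E_{j,i})$. Call $T$ a biprojection if it is selfdual ($T^*=T$), unital ($T(\mathrm{id})=\mathrm{id}$), idempotent ($T\circ T=T$) and convolution-stable (there is a nonzero scalar $\lambda\in\mathbb{C}$ with $T*T=\lambda T$). Then every biprojection $T$ on $M_n(\mathbb{C})$ satisfies the exchange relations: for all $X,Y\in M_n(\mathbb{C})$, $$T(T(X)Y)=T(X)T(Y)=T(XT(Y)).$$ -/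

import Mathlib

open scoped TensorProduct

/-- A Frobenius algebra structure, in the monoidal category of `k`-vector spaces, on a unital
associative `k`-algebra `A`: a counital coalgebra `(A, comul, counit)` that satisfies the
Frobenius condition with the multiplication of `A`. -/
structure FrobeniusStructure (k A : Type*) [Field k] [Ring A] [Algebra k A] where
  /-- the comultiplication `δ` -/
  comul : A →ₗ[k] A ⊗[k] A
  /-- the counit `ε` -/
  counit : A →ₗ[k] k
  /-- `(δ ⊗ id) ∘ δ = (id ⊗ δ) ∘ δ` -/
  coassoc : (TensorProduct.assoc k A A A).toLinearMap ∘ₗ comul.rTensor A ∘ₗ comul =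
    comul.lTensor A ∘ₗ comul
  /-- `(ε ⊗ id) ∘ δ = id` -/
  counit_left : (TensorProduct.lid k A).toLinearMap ∘ₗ counit.rTensor A ∘ₗ comul = LinearMap.id
  /-- `(id ⊗ ε) ∘ δ = id` -/
  counit_right : (TensorProduct.rid k A).toLinearMap ∘ₗ counit.lTensor A ∘ₗ comul = LinearMap.id
  /-- `(id ⊗ m) ∘ (δ ⊗ id) = δ ∘ m` -/
  frobenius_left : (LinearMap.mul' k A).lTensor A ∘ₗ (TensorProduct.assoc k A A A).toLinearMap ∘ₗ
    comul.rTensor A = comul ∘ₗ LinearMap.mul' k A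
  /-- `(m ⊗ id) ∘ (id ⊗ δ) = δ ∘ m` -/
  frobenius_right : (LinearMap.mul' k A).rTensor A ∘ₗ
    (TensorProduct.assoc k A A A).symm.toLinearMap ∘ₗ comul.lTensor A = comul ∘ₗ LinearMap.mul' k A

namespace FrobeniusStructure

variable {k A : Type*} [Field k] [Ring A] [Algebra k A] (F : FrobeniusStructure k A)

/-- The evaluation morphism `ε ∘ m`, which together with `coev` makes `A` its own dual. -/
noncomputable def ev : A ⊗[k] A →ₗ[k] k := F.counit ∘ₗ LinearMap.mul' k A

/-- The coevaluation morphism `δ ∘ e`, where `e` is the unit morphism of `A`. -/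
noncomputable def coev : k →ₗ[k] A ⊗[k] A := F.comul ∘ₗ Algebra.linearMap k A

/-- The dual `f* = (ev ⊗ id) ∘ (id ⊗ f ⊗ id) ∘ (id ⊗ coev)` of an endomorphism `f`. -/
noncomputable def dual (f : A →ₗ[k] A) : A →ₗ[k] A :=
  (TensorProduct.lid k A).toLinearMap ∘ₗ F.ev.rTensor A ∘ₗ
    (TensorProduct.assoc k A A A).symm.toLinearMap ∘ₗ (f.rTensor A).lTensor A ∘ₗ
      F.coev.lTensor A ∘ₗ (TensorProduct.rid k A).symm.toLinearMap

/-- The convolution product `f * g = m ∘ (f ⊗ g) ∘ δ` of two endomorphisms. -/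
noncomputable def conv (f g : A →ₗ[k] A) : A →ₗ[k] A :=
  LinearMap.mul' k A ∘ₗ TensorProduct.map f g ∘ₗ F.comul

/-- A biprojection: a selfdual unital idempotent endomorphism that is convolution-stable. -/
structure IsBiprojection (b : A →ₗ[k] A) : Prop where
  selfdual : F.dual b = b
  unital : b ∘ₗ Algebra.linearMap k A = Algebra.linearMap k A
  idempotent : b ∘ₗ b = b
  conv_stable : ∃ c : k, c ≠ 0 ∧ F.conv b b = c • b

end FrobeniusStructure

/-- The exchange relations `b ∘ m ∘ (b ⊗ id) = m ∘ (b ⊗ b) = b ∘ m ∘ (id ⊗ b)`. -/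
def ExchangeRelations {k A : Type*} [Field k] [Ring A] [Algebra k A] (b : A →ₗ[k] A) : Prop :=
  b ∘ₗ LinearMap.mul' k A ∘ₗ b.rTensor A = LinearMap.mul' k A ∘ₗ TensorProduct.map b b ∧
    LinearMap.mul' k A ∘ₗ TensorProduct.map b b = b ∘ₗ LinearMap.mul' k A ∘ₗ b.lTensor A

theorem exchangeRelations_iff {k A : Type*} [Field k] [Ring A] [Algebra k A] (b : A →ₗ[k] A) :
    ExchangeRelations b ↔
      ∀ x y : A, b (b x * y) = b x * b y ∧ b x * b y = b (x * b y) := by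
  constructor
  · rintro ⟨h₁, h₂⟩ x y
    exact ⟨by simpa using LinearMap.congr_fun h₁ (x ⊗ₜ y),
      by simpa using LinearMap.congr_fun h₂ (x ⊗ₜ y)⟩
  · intro h
    exact ⟨TensorProduct.ext' fun x y => by simpa using (h x y).1,
      TensorProduct.ext' fun x y => by simpa using (h x y).2⟩

section MatrixFrobenius

variable (k : Type*) [Field k] (n : ℕ)

/-- The comultiplication `X ↦ ∑ i j, X E_{i,j} ⊗ E_{j,i}` of the matrix algebra, attached to the
nondegenerate associative form `(X, Y) ↦ Tr (X Y)`. -/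
noncomputable def matrixComul :
    Matrix (Fin n) (Fin n) k →ₗ[k] Matrix (Fin n) (Fin n) k ⊗[k] Matrix (Fin n) (Fin n) k :=
  ∑ i, ∑ j, (TensorProduct.mk k _ _).flip (Matrix.single j i (1 : k)) ∘ₗ
    LinearMap.mulRight k (Matrix.single i j (1 : k))

theorem matrixComul_apply (X : Matrix (Fin n) (Fin n) k) :
    matrixComul k n X =
      ∑ i, ∑ j, (X * Matrix.single i j (1 : k)) ⊗ₜ[k] Matrix.single j i (1 : k) := by
  simp [matrixComul]

theorem sum_trace_single (X : Matrix (Fin n) (Fin n) k) :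
    ∑ i, ∑ j, (X * Matrix.single i j (1 : k)).trace • Matrix.single j i (1 : k) = X := by
  conv_rhs => rw [Matrix.matrix_eq_sum_single X]
  rw [Finset.sum_comm]
  simp [Matrix.trace_mul_single]

theorem matrixComul_mul (X Y : Matrix (Fin n) (Fin n) k) :
    matrixComul k n (X * Y) =
      ∑ i, ∑ j, (X * Matrix.single i j (1 : k)) ⊗ₜ[k] (Matrix.single j i (1 : k) * Y) := by
  have h₁ : ∀ i j : Fin n, Y * Matrix.single i j (1 : k) = ∑ a, Y a i • Matrix.single a j 1 := by
    intro i j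
    ext p q
    by_cases h : j = q <;>
      simp [Matrix.sum_apply, Matrix.mul_apply, Matrix.single_apply, h]
  have h₂ : ∀ i j : Fin n, Matrix.single j i (1 : k) * Y = ∑ b, Y i b • Matrix.single j b 1 := by
    intro i j
    ext p q
    by_cases h : j = p <;>
      simp [Matrix.sum_apply, Matrix.mul_apply, Matrix.single_apply, h]
  simp only [matrixComul_apply, mul_assoc, h₁, h₂, Finset.mul_sum, TensorProduct.sum_tmul,
    TensorProduct.tmul_sum, mul_smul_comm, TensorProduct.smul_tmul', TensorProduct.tmul_smul]
  rw [Finset.sum_comm]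
  conv_rhs => rw [Finset.sum_comm]
  exact Finset.sum_congr rfl fun j _ => Finset.sum_comm

theorem matrixComul_apply' (X : Matrix (Fin n) (Fin n) k) :
    matrixComul k n X =
      ∑ i, ∑ j, Matrix.single i j (1 : k) ⊗ₜ[k] (Matrix.single j i (1 : k) * X) := by
  simpa using matrixComul_mul k n 1 X

/-- The Frobenius algebra `M_n(k)` with bilinear form `(X, Y) ↦ Tr (X Y)`: the counit is the
trace. -/
noncomputable def matrixFrobenius : FrobeniusStructure k (Matrix (Fin n) (Fin n) k) where
  comul := matrixComul k n
  counit := Matrix.traceLinearMap (Fin n) k k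
  coassoc := by
    ext1 X
    simp only [LinearMap.comp_apply, matrixComul_apply k n X, map_sum, LinearMap.rTensor_tmul,
      LinearMap.lTensor_tmul]
    have h : ∀ i j : Fin n, matrixComul k n (X * Matrix.single i j (1 : k)) =
      ∑ p, ∑ q, (X * Matrix.single p q (1 : k)) ⊗ₜ[k]
        (Matrix.single q p (1 : k) * Matrix.single i j (1 : k)) := fun i j =>
      matrixComul_mul k n X _
    simp only [h, TensorProduct.sum_tmul, map_sum, LinearEquiv.coe_coe, TensorProduct.assoc_tmul]
    simp only [matrixComul_apply, TensorProduct.tmul_sum]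
    rw [Finset.sum_comm_cycle]
    exact Finset.sum_congr rfl fun p _ => Finset.sum_comm_cycle
  counit_left := by
    ext1 X
    simpa [matrixComul_apply] using sum_trace_single k n X
  counit_right := by
    ext1 X
    simp only [LinearMap.comp_apply, matrixComul_apply' k n X, map_sum, LinearMap.lTensor_tmul]
    simp only [LinearEquiv.coe_coe, TensorProduct.rid_tmul, Matrix.traceLinearMap_apply,
      LinearMap.id_apply]
    conv_rhs => rw [← sum_trace_single k n X, Finset.sum_comm]
    simp [Matrix.trace_mul_comm X]
  frobenius_left := by
    refine TensorProduct.ext' fun X Y => ?_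
    simp only [LinearMap.comp_apply, LinearMap.rTensor_tmul, LinearMap.mul'_apply,
      matrixComul_mul, matrixComul_apply k n X]
    simp [TensorProduct.sum_tmul]
  frobenius_right := by
    refine TensorProduct.ext' fun X Y => ?_
    simp [matrixComul_apply, TensorProduct.tmul_sum, mul_assoc]

theorem matrixFrobenius_dual_apply (T : Matrix (Fin n) (Fin n) k →ₗ[k] Matrix (Fin n) (Fin n) k)
    (X : Matrix (Fin n) (Fin n) k) :
    (matrixFrobenius k n).dual T X =
      ∑ i, ∑ j, (X * T (Matrix.single i j 1)).trace • Matrix.single j i (1 : k) := by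
  have h : (matrixFrobenius k n).coev 1 = ∑ i, ∑ j,
      Matrix.single i j (1 : k) ⊗ₜ[k] Matrix.single j i (1 : k) := by
    simp [FrobeniusStructure.coev, matrixFrobenius, matrixComul_apply]
  simp [FrobeniusStructure.dual, h, FrobeniusStructure.ev, TensorProduct.tmul_sum]
  simp [matrixFrobenius]

theorem matrixFrobenius_conv_apply
    (S T : Matrix (Fin n) (Fin n) k →ₗ[k] Matrix (Fin n) (Fin n) k)
    (X : Matrix (Fin n) (Fin n) k) :
    (matrixFrobenius k n).conv S T X =
      ∑ i, ∑ j, S (X * Matrix.single i j 1) * T (Matrix.single j i 1) := by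
  simp [FrobeniusStructure.conv, matrixFrobenius, matrixComul_apply]

end MatrixFrobenius

/-! ### Symmetric idempotents for the trace form -/

section TraceSymmetric

variable {k : Type*} [Field k] {n : ℕ}

/-! A selfdual idempotent `T` is the orthogonal projection onto its range for the trace form, so the
exchange relations hold once that range is closed under multiplication
(`TraceSymmetric.exchangeRelations`).

The rank of `T` is very restricted: `T * T = c T` makes `c⁻¹ • sandwich T` idempotent too, and the
ranks `n c` of `T` and `n / c` of this map multiply to `n ^ 2`. For `1 ≤ n ≤ 3` the rank is
therefore `1`, `n ^ 2`, or `n` itself. The first two cases give the normalized trace and the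
identity. For `n = 2` the range is spanned by `1` and a traceless `a`, whose square is scalar. For
`n = 3` it is spanned by `1` and traceless orthonormal `a`, `b`; stability under convolution becomes
a tensor identity that forces the products of `a` and `b` back into the range. -/

/-- Symmetry of an endomorphism of `M_n(k)` for the bilinear form `(X, Y) ↦ Tr (X Y)`. -/
def TraceSymmetric (T : Matrix (Fin n) (Fin n) k →ₗ[k] Matrix (Fin n) (Fin n) k) : Prop :=
  ∀ X Y, (T X * Y).trace = (X * T Y).trace

theorem traceSymmetric_of_dual_eq (T : Matrix (Fin n) (Fin n) k →ₗ[k] Matrix (Fin n) (Fin n) k)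
    (h : (matrixFrobenius k n).dual T = T) : TraceSymmetric T := by
  intro X Y
  conv_lhs => rw [← h, matrixFrobenius_dual_apply]
  conv_rhs => rw [Matrix.matrix_eq_sum_single Y]
  have h₁ : ∀ i j, Matrix.single i j (Y i j) = Y i j • Matrix.single i j (1 : k) := by
    intro i j; simp
  simp only [h₁, map_sum, map_smul, Finset.mul_sum, Finset.sum_mul, Matrix.trace_sum,
    Matrix.mul_smul, Matrix.smul_mul, Matrix.trace_smul, Matrix.trace_single_mul, smul_eq_mul]
  refine Finset.sum_congr rfl fun i _ => Finset.sum_congr rfl fun j _ => ?_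
  simp [mul_comm]

theorem trace_eq_sum_single (T : Matrix (Fin n) (Fin n) k →ₗ[k] Matrix (Fin n) (Fin n) k) :
    LinearMap.trace k _ T = ∑ i, ∑ j, T (Matrix.single i j 1) i j := by
  rw [LinearMap.trace_eq_matrix_trace k (Matrix.stdBasis k (Fin n) (Fin n)), Matrix.trace,
    Fintype.sum_prod_type]
  simp only [Matrix.diag_apply, LinearMap.toMatrix_apply, Matrix.stdBasis_eq_single]
  rfl

/-- The endomorphism `X ↦ Tr (X A) C`. -/
noncomputable def traceRankOne (A C : Matrix (Fin n) (Fin n) k) :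
    Matrix (Fin n) (Fin n) k →ₗ[k] Matrix (Fin n) (Fin n) k :=
  (Matrix.traceLinearMap (Fin n) k k ∘ₗ LinearMap.mulRight k A).smulRight C

@[simp]
theorem traceRankOne_apply (A C X : Matrix (Fin n) (Fin n) k) :
    traceRankOne A C X = (X * A).trace • C := rfl

theorem conv_traceRankOne (A B C D : Matrix (Fin n) (Fin n) k) :
    (matrixFrobenius k n).conv (traceRankOne A C) (traceRankOne B D) =
      traceRankOne (B * A) (C * D) := by
  ext1 X
  have h := congrArg (fun Z => (X * Z * A).trace • (C * D)) (sum_trace_single k n B)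
  simp only [traceRankOne_apply, ← mul_assoc]
  rw [← h, matrixFrobenius_conv_apply, Finset.sum_comm]
  simp only [traceRankOne_apply, Finset.mul_sum, Finset.sum_mul, Matrix.trace_sum,
    Finset.sum_smul, Matrix.mul_smul, Matrix.smul_mul, Matrix.trace_smul, smul_smul, smul_eq_mul]
  refine Finset.sum_congr rfl fun i _ => Finset.sum_congr rfl fun j _ => ?_
  rw [Matrix.trace_mul_comm B]

theorem trace_traceRankOne (A C : Matrix (Fin n) (Fin n) k) :
    LinearMap.trace k _ (traceRankOne A C) = (C * A).trace := by
  simp [traceRankOne]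

variable {T : Matrix (Fin n) (Fin n) k →ₗ[k] Matrix (Fin n) (Fin n) k}

theorem TraceSymmetric.sub_traceRankOne (hs : TraceSymmetric T) (c : k)
    (a : Matrix (Fin n) (Fin n) k) : TraceSymmetric (T - c • traceRankOne a a) := by
  intro X Y
  have := hs X Y
  simp only [LinearMap.sub_apply, LinearMap.smul_apply, traceRankOne_apply, Matrix.sub_mul,
    Matrix.mul_sub, Matrix.trace_sub, Matrix.smul_mul, Matrix.mul_smul, Matrix.trace_smul, this,
    Matrix.trace_mul_comm a Y, smul_eq_mul]
  ring

/-- A Gram–Schmidt step: splitting off a nonisotropic fixed vector leaves a symmetric idempotent of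
trace one less. -/
theorem isIdempotentElem_sub_traceRankOne (hs : TraceSymmetric T) (hi : IsIdempotentElem T)
    {a : Matrix (Fin n) (Fin n) k} (ha : T a = a) {c : k} (hc : c * (a * a).trace = 1) :
    IsIdempotentElem (T - c • traceRankOne a a) := by
  have hi' : ∀ X, T (T X) = T X := LinearMap.congr_fun hi
  ext1 X
  simp only [Module.End.mul_apply, LinearMap.sub_apply, LinearMap.smul_apply, traceRankOne_apply,
    map_sub, map_smul, ha, hi', hs X a]
  rw [smul_smul c (a * a).trace, hc, one_smul, sub_self, smul_zero, smul_zero, sub_zero]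

theorem trace_sub_traceRankOne {a : Matrix (Fin n) (Fin n) k} {c : k}
    (hc : c * (a * a).trace = 1) :
    LinearMap.trace k _ (T - c • traceRankOne a a) = LinearMap.trace k _ T - 1 := by
  simp [trace_traceRankOne, hc]

/-- If every fixed vector were isotropic, polarization would make the form vanish on the range, and
symmetry with nondegeneracy would give `T = 0`. A nonisotropic vector is normalized by a square
root. -/
theorem TraceSymmetric.exists_trace_mul_self_eq_one [IsAlgClosed k] [CharZero k]
    (hs : TraceSymmetric T) (hi : IsIdempotentElem T) (h0 : T ≠ 0) :
    ∃ a, T a = a ∧ (a * a).trace = 1 := by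
  have hi' : ∀ X, T (T X) = T X := LinearMap.congr_fun hi
  by_contra! h
  have hz : ∀ a, T a = a → (a * a).trace = 0 := by
    intro a ha
    by_contra hne
    obtain ⟨z, hz⟩ := IsAlgClosed.exists_pow_nat_eq ((a * a).trace)⁻¹ (n := 2) (by norm_num)
    refine h (z • a) (by simp [ha]) ?_
    simp only [Matrix.smul_mul, Matrix.mul_smul, Matrix.trace_smul, smul_eq_mul]
    rw [← mul_assoc, ← sq, hz, inv_mul_cancel₀ hne]
  apply h0
  ext1 X
  apply Matrix.ext_iff_trace_mul_right.2
  intro Y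
  have h₁ : (T X * Y).trace = (T X * T Y).trace := by rw [← hs (T X) Y, hi']
  have h₂ := hz (T X + T Y) (by simp [hi'])
  simp only [Matrix.add_mul, Matrix.mul_add, Matrix.trace_add, hz (T X) (hi' X), hz (T Y) (hi' Y),
    Matrix.trace_mul_comm (T Y) (T X)] at h₂
  rw [h₁]
  simpa using (by linear_combination h₂ / 2 : (T X * T Y).trace = 0)

/-- Pairing with a product of fixed elements sees only `T Z`; each relation is tested against all
`Z` and `T` is moved across the trace. -/
theorem TraceSymmetric.exchangeRelations (hs : TraceSymmetric T)
    (hmul : ∀ X Y, T (T X * T Y) = T X * T Y) : ExchangeRelations T := by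
  rw [exchangeRelations_iff]
  have h : ∀ X Y Z, (T X * T Y * Z).trace = (T X * T Y * T Z).trace := by
    intro X Y Z
    rw [← hmul X Y, hs, hmul]
  intro X Y
  constructor
  · refine Matrix.ext_iff_trace_mul_right.2 fun Z => ?_
    rw [h, hs, Matrix.trace_mul_cycle, Matrix.trace_mul_cycle (T X), h]
  · refine Matrix.ext_iff_trace_mul_right.2 fun Z => ?_
    rw [h, hs, mul_assoc, mul_assoc, Matrix.trace_mul_comm, Matrix.trace_mul_comm X]
    exact (h Y Z X).symm

/-! ### Convolution as composition, and divisibility of the rank -/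

/-- The endomorphism `X ↦ ∑ i j, T E_{i,j} X E_{j,i}`. -/
noncomputable def sandwich (T : Matrix (Fin n) (Fin n) k →ₗ[k] Matrix (Fin n) (Fin n) k) :
    Matrix (Fin n) (Fin n) k →ₗ[k] Matrix (Fin n) (Fin n) k :=
  ∑ i, ∑ j, LinearMap.mulRight k (Matrix.single j i 1) ∘ₗ
    LinearMap.mulLeft k (T (Matrix.single i j 1))

theorem sandwich_apply (T : Matrix (Fin n) (Fin n) k →ₗ[k] Matrix (Fin n) (Fin n) k)
    (X : Matrix (Fin n) (Fin n) k) :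
    sandwich T X = ∑ i, ∑ j, T (Matrix.single i j 1) * X * Matrix.single j i 1 := by
  simp [sandwich]

theorem sandwich_smul (c : k) (T : Matrix (Fin n) (Fin n) k →ₗ[k] Matrix (Fin n) (Fin n) k) :
    sandwich (c • T) = c • sandwich T := by
  ext1 X
  simp [sandwich_apply, Finset.smul_sum]

/-- On both sides the factor to the left of `X * E_{q,i}` is `∑ j, S E_{i,j} * T E_{j,q}`. -/
theorem sandwich_comp_sandwich
    (S T : Matrix (Fin n) (Fin n) k →ₗ[k] Matrix (Fin n) (Fin n) k) :
    sandwich S ∘ₗ sandwich T = sandwich ((matrixFrobenius k n).conv S T) := by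
  have h₁ : ∀ i j p q : Fin n, Matrix.single i j (1 : k) * Matrix.single p q 1 =
      if j = p then Matrix.single i q 1 else 0 := by
    intro i j p q
    split_ifs with h
    · subst h; simp
    · simp [h]
  ext1 X
  simp only [LinearMap.comp_apply, sandwich_apply, matrixFrobenius_conv_apply, Finset.mul_sum,
    Finset.sum_mul, mul_assoc, h₁, apply_ite S, map_zero, ite_mul, zero_mul, mul_ite, mul_zero,
    Finset.sum_ite_eq, Finset.sum_ite_irrel, Finset.sum_const_zero, Finset.mem_univ, if_true]
  simp only [Finset.sum_ite_eq', Finset.mem_univ, if_true]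
  exact Finset.sum_congr rfl fun i _ => Finset.sum_comm

theorem trace_sandwich (T : Matrix (Fin n) (Fin n) k →ₗ[k] Matrix (Fin n) (Fin n) k) :
    LinearMap.trace k _ (sandwich T) = (T 1).trace := by
  have h₁ : (1 : Matrix (Fin n) (Fin n) k) = ∑ i, Matrix.single i i 1 := by
    ext p q
    simp [Matrix.sum_apply, Matrix.single_apply, Matrix.one_apply, ite_and]
  have h₂ : ∀ A B : Matrix (Fin n) (Fin n) k, LinearMap.trace k _
      (LinearMap.mulRight k B ∘ₗ LinearMap.mulLeft k A) = A.trace * B.trace := by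
    intro A B
    rw [trace_eq_sum_single]
    simp [Matrix.trace, Finset.sum_mul_sum, Matrix.mul_apply, Matrix.single_apply, ite_and]
  rw [h₁, map_sum, sandwich]
  simp only [map_sum, h₂, Matrix.trace_sum]
  refine Finset.sum_congr rfl fun i _ => ?_
  rw [Finset.sum_eq_single i]
  · simp
  · intro j _ hj
    simp [hj]
  · simp

/-- Evaluate `T * T = c T` at `1` and take traces: symmetry and idempotence turn the left side into
the trace of `T`. -/
theorem TraceSymmetric.trace_eq_mul_of_conv_self (hs : TraceSymmetric T) (hi : IsIdempotentElem T)
    (h1 : T 1 = 1) {c : k} (hc : (matrixFrobenius k n).conv T T = c • T) :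
    LinearMap.trace k _ T = n * c := by
  have hi' : ∀ X, T (T X) = T X := LinearMap.congr_fun hi
  have h := congrArg Matrix.trace (LinearMap.congr_fun hc 1)
  simp only [matrixFrobenius_conv_apply, one_mul, LinearMap.smul_apply, h1, Matrix.trace_smul,
    Matrix.trace_one, Matrix.trace_sum, ← hs (T _), hi', Matrix.trace_mul_single] at h
  rw [trace_eq_sum_single]
  simpa [mul_comm] using h

/-- The rank of a biprojection of `M_n(k)` divides `n ^ 2`. -/
theorem TraceSymmetric.exists_trace_eq_natCast_dvd_sq [CharZero k] [NeZero n]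
    (hs : TraceSymmetric T)
    (hi : IsIdempotentElem T) (h1 : T 1 = 1) {c : k} (hc0 : c ≠ 0)
    (hc : (matrixFrobenius k n).conv T T = c • T) :
    ∃ d : ℕ, d ∣ n ^ 2 ∧ LinearMap.trace k _ T = d := by
  have ht := hs.trace_eq_mul_of_conv_self hi h1 hc
  have hp : IsIdempotentElem (c⁻¹ • sandwich T) := by
    change (c⁻¹ • sandwich T) ∘ₗ (c⁻¹ • sandwich T) = _
    rw [LinearMap.comp_smul, LinearMap.smul_comp, sandwich_comp_sandwich, hc, sandwich_smul,
      smul_smul c⁻¹ c, inv_mul_cancel₀ hc0, one_smul]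
  -- The rank of this idempotent is its trace `n / c`, the cofactor of `n c` in `n ^ 2`.
  have hr := (LinearMap.IsIdempotentElem.isProj_range _ hp).trace
  rw [map_smul, trace_sandwich, h1, Matrix.trace_one, Fintype.card_fin, smul_eq_mul] at hr
  refine ⟨_, Dvd.intro (Module.finrank k (LinearMap.range (c⁻¹ • sandwich T))) ?_,
    (LinearMap.IsIdempotentElem.isProj_range _ hi).trace⟩
  rw [← Nat.cast_inj (R := k), Nat.cast_mul, ← (LinearMap.IsIdempotentElem.isProj_range _ hi).trace, ← hr, ht]
  push_cast
  field_simp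

end TraceSymmetric

/-! ### Orthogonal decomposition in ranks one, two and three -/

section Biprojection

variable {k : Type*} [Field k] {n : ℕ}
variable {T : Matrix (Fin n) (Fin n) k →ₗ[k] Matrix (Fin n) (Fin n) k}

/-- An idempotent endomorphism whose trace is the full dimension is the identity. -/
theorem eq_id_of_trace_eq_sq [CharZero k] (hi : IsIdempotentElem T)
    (ht : LinearMap.trace k _ T = (n : k) ^ 2) : T = LinearMap.id := by
  have h := LinearMap.IsIdempotentElem.eq_zero_of_trace_eq_zero hi.one_sub
    (by rw [map_sub, LinearMap.trace_one, ht]; simp [sq, Module.finrank_matrix])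
  exact (sub_eq_zero.1 h).symm

/-- The deflated map is symmetric and kills `u`, so its fixed vectors are orthogonal to `u`, where
it agrees with `T`. -/
theorem TraceSymmetric.fixed_and_orthogonal (hs : TraceSymmetric T)
    {u : Matrix (Fin n) (Fin n) k} (hu : T u = u) {c : k} (hc : c * (u * u).trace = 1)
    {b : Matrix (Fin n) (Fin n) k} (hb : (T - c • traceRankOne u u) b = b) :
    T b = b ∧ (b * u).trace = 0 := by
  have h₁ : (T - c • traceRankOne u u) u = 0 := by
    simp [hu, smul_smul, hc]
  have h₂ : (b * u).trace = 0 := by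
    conv_lhs => rw [← hb]
    rw [hs.sub_traceRankOne c u, h₁]
    simp
  refine ⟨?_, h₂⟩
  simpa [h₂] using hb

variable [CharZero k] [NeZero n]

theorem inv_mul_trace_one :
    (n : k)⁻¹ * ((1 : Matrix (Fin n) (Fin n) k) * 1).trace = 1 := by
  simp [NeZero.ne n]

/-- A unital symmetric idempotent of rank one is the normalized trace. -/
theorem TraceSymmetric.eq_of_trace_eq_one (hs : TraceSymmetric T) (hi : IsIdempotentElem T)
    (h1 : T 1 = 1) (ht : LinearMap.trace k _ T = 1) : T = (n : k)⁻¹ • traceRankOne 1 1 := by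
  rw [← sub_eq_zero]
  refine LinearMap.IsIdempotentElem.eq_zero_of_trace_eq_zero
    (isIdempotentElem_sub_traceRankOne hs hi h1 inv_mul_trace_one) ?_
  rw [trace_sub_traceRankOne inv_mul_trace_one, ht, sub_self]

variable [IsAlgClosed k]

/-- A unital symmetric idempotent of rank two is the orthogonal projection onto the span of `1`
and a traceless normalized matrix. -/
theorem TraceSymmetric.exists_eq_of_trace_eq_two (hs : TraceSymmetric T) (hi : IsIdempotentElem T)
    (h1 : T 1 = 1) (ht : LinearMap.trace k _ T = 2) :
    ∃ a, T a = a ∧ a.trace = 0 ∧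
      T = (n : k)⁻¹ • traceRankOne 1 1 + traceRankOne a a := by
  have hs₀ := hs.sub_traceRankOne (n : k)⁻¹ 1
  have hi₀ := isIdempotentElem_sub_traceRankOne hs hi h1 inv_mul_trace_one
  have ht₀ := trace_sub_traceRankOne (T := T) (inv_mul_trace_one (k := k) (n := n))
  obtain ⟨a, ha, haa⟩ := hs₀.exists_trace_mul_self_eq_one hi₀ (by
    intro h
    rw [h, ht] at ht₀
    norm_num at ht₀)
  obtain ⟨hTa, hta⟩ := hs.fixed_and_orthogonal h1 inv_mul_trace_one ha
  have haa' : (1 : k) * (a * a).trace = 1 := by rw [haa, one_mul]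
  have h := LinearMap.IsIdempotentElem.eq_zero_of_trace_eq_zero
    (isIdempotentElem_sub_traceRankOne hs₀ hi₀ ha haa')
    (by rw [trace_sub_traceRankOne haa', ht₀, ht]; norm_num)
  refine ⟨a, hTa, by simpa using hta, ?_⟩
  rw [one_smul, sub_sub, sub_eq_zero] at h
  exact h

/-- A unital symmetric idempotent of rank three is the orthogonal projection onto the span of `1`
and two traceless orthonormal matrices. -/
theorem TraceSymmetric.exists_eq_of_trace_eq_three (hs : TraceSymmetric T)
    (hi : IsIdempotentElem T) (h1 : T 1 = 1) (ht : LinearMap.trace k _ T = 3) :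
    ∃ a b, T a = a ∧ T b = b ∧ a.trace = 0 ∧ b.trace = 0 ∧ (a * a).trace = 1 ∧
      (b * b).trace = 1 ∧ (a * b).trace = 0 ∧
      T = (n : k)⁻¹ • traceRankOne 1 1 + traceRankOne a a + traceRankOne b b := by
  have hs₀ := hs.sub_traceRankOne (n : k)⁻¹ 1
  have hi₀ := isIdempotentElem_sub_traceRankOne hs hi h1 inv_mul_trace_one
  have ht₀ := trace_sub_traceRankOne (T := T) (inv_mul_trace_one (k := k) (n := n))
  obtain ⟨a, ha, haa⟩ := hs₀.exists_trace_mul_self_eq_one hi₀ (by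
    intro h
    rw [h, ht] at ht₀
    norm_num at ht₀)
  obtain ⟨hTa, hta⟩ := hs.fixed_and_orthogonal h1 inv_mul_trace_one ha
  have haa' : (1 : k) * (a * a).trace = 1 := by rw [haa, one_mul]
  have hs₁ := hs₀.sub_traceRankOne 1 a
  have hi₁ := isIdempotentElem_sub_traceRankOne hs₀ hi₀ ha haa'
  have ht₁ := trace_sub_traceRankOne (T := T - (n : k)⁻¹ • traceRankOne 1 1) haa'
  obtain ⟨b, hb, hbb⟩ := hs₁.exists_trace_mul_self_eq_one hi₁ (by
    intro h
    rw [h, ht₀, ht] at ht₁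
    norm_num at ht₁)
  obtain ⟨hTb₀, hba⟩ := hs₀.fixed_and_orthogonal ha haa' hb
  obtain ⟨hTb, htb⟩ := hs.fixed_and_orthogonal h1 inv_mul_trace_one hTb₀
  have hbb' : (1 : k) * (b * b).trace = 1 := by rw [hbb, one_mul]
  have h := LinearMap.IsIdempotentElem.eq_zero_of_trace_eq_zero
    (isIdempotentElem_sub_traceRankOne hs₁ hi₁ hb hbb')
    (by rw [trace_sub_traceRankOne hbb', ht₁, ht₀, ht]; norm_num)
  refine ⟨a, b, hTa, hTb, by simpa using hta, by simpa using htb, haa, hbb, ?_, ?_⟩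
  · rw [Matrix.trace_mul_comm, hba]
  · rw [one_smul, one_smul, sub_sub, sub_sub, sub_eq_zero] at h
    rw [h, add_assoc]

end Biprojection

/-! ### Closure of the range under multiplication -/

section SmallRank

variable {k : Type*} [Field k]

/-- Cayley–Hamilton with vanishing trace. -/
theorem mul_self_eq_of_trace_eq_zero {a : Matrix (Fin 2) (Fin 2) k} (h : a.trace = 0) :
    a * a = (-a.det) • (1 : Matrix (Fin 2) (Fin 2) k) := by
  rw [Matrix.trace_fin_two] at h
  ext i j
  fin_cases i <;> fin_cases j <;>
    simp [Matrix.mul_apply, Fin.sum_univ_two, Matrix.det_fin_two]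
  · linear_combination a 0 0 * h
  · linear_combination a 0 1 * h
  · linear_combination a 1 0 * h
  · linear_combination a 1 1 * h

/-- If a tensor of the shape `∑ i, ± q i ⊗ q i`, `i < 3`, equals `r (a ⊗ a + b ⊗ b)`, then its
components lie in the span of `a` and `b`, tested here by a symmetric idempotent `T` fixing `a` and
`b`. -/
theorem TraceSymmetric.apply_eq_self_of_tensor_eq {n : ℕ}
    {T : Matrix (Fin n) (Fin n) k →ₗ[k] Matrix (Fin n) (Fin n) k} (hs : TraceSymmetric T)
    {a b : Matrix (Fin n) (Fin n) k} (ha : T a = a) (hb : T b = b) (haa : (a * a).trace = 1)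
    (hbb : (b * b).trace = 1) (hab : (a * b).trace = 0) (q : Fin 3 → Matrix (Fin n) (Fin n) k)
    (e : Fin 3 → k) (he : ∀ i, e i ≠ 0) {r : k} (hr : r ≠ 0)
    (h : ∀ X, ∑ i, (e i * (X * q i).trace) • q i =
      r • ((X * a).trace • a + (X * b).trace • b)) (i : Fin 3) : T (q i) = q i := by
  by_cases hq : LinearIndependent k q
  · rw [Fintype.linearIndependent_iff] at hq
    refine Matrix.ext_iff_trace_mul_left.2 fun Y => ?_
    -- `Y - T Y` is orthogonal to the range, so the right side vanishes there and independence kills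
    -- each coefficient.
    have h₁ : ∀ c, T c = c → ((Y - T Y) * c).trace = 0 := by
      intro c hc
      rw [Matrix.sub_mul, Matrix.trace_sub, hs, hc, sub_self]
    have h₂ := hq _ ((h (Y - T Y)).trans (by simp [h₁ a ha, h₁ b hb])) i
    rw [Matrix.sub_mul, Matrix.trace_sub, hs] at h₂
    exact (sub_eq_zero.1 ((mul_eq_zero.1 h₂).resolve_left (he i))).symm
  · have hba : (b * a).trace = 0 := by rw [Matrix.trace_mul_comm, hab]
    have hmem : ∀ X, (X * a).trace • a + (X * b).trace • b ∈ Submodule.span k (Set.range q) := by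
      intro X
      have h₁ : r⁻¹ • r • ((X * a).trace • a + (X * b).trace • b) ∈
          Submodule.span k (Set.range q) := by
        rw [← h X]
        exact Submodule.smul_mem _ _ (Submodule.sum_mem _ fun i _ =>
          Submodule.smul_mem _ _ (Submodule.subset_span ⟨i, rfl⟩))
      rwa [inv_smul_smul₀ hr] at h₁
    have hma := hmem a
    have hmb := hmem b
    rw [haa, hab, one_smul, zero_smul, add_zero] at hma
    rw [hba, hbb, one_smul, zero_smul, zero_add] at hmb
    have hle : Submodule.span k (Set.range ![a, b]) ≤ Submodule.span k (Set.range q) := by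
      rw [Submodule.span_le]
      rintro _ ⟨j, rfl⟩
      fin_cases j
      · exact hma
      · exact hmb
    have hli : LinearIndependent k ![a, b] := by
      rw [LinearIndependent.pair_iff]
      intro s t hst
      have h₁ := congrArg (fun Z => (Z * a).trace) hst
      have h₂ := congrArg (fun Z => (Z * b).trace) hst
      simp [Matrix.add_mul, haa, hba, hab, hbb] at h₁ h₂
      exact ⟨h₁, h₂⟩
    -- Dependence bounds the span of `q` by dimension two, already filled by `a` and `b`.
    have heq := Submodule.eq_of_le_of_finrank_le hle (by
      rw [finrank_span_eq_card hli]
      rw [linearIndependent_iff_card_le_finrank_span] at hq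
      simp only [Fintype.card_fin, Set.finrank] at hq ⊢
      omega)
    have hfix : Submodule.span k (Set.range ![a, b]) ≤ LinearMap.eqLocus T LinearMap.id := by
      rw [Submodule.span_le]
      rintro _ ⟨j, rfl⟩
      fin_cases j
      · exact ha
      · exact hb
    exact hfix (heq ▸ Submodule.subset_span ⟨i, rfl⟩)

/-- The range of a unital symmetric idempotent of rank three on `M_3(k)` that is stable under
convolution is closed under multiplication. -/
theorem TraceSymmetric.mul_mem_of_trace_eq_three [CharZero k] [IsAlgClosed k]
    {T : Matrix (Fin 3) (Fin 3) k →ₗ[k] Matrix (Fin 3) (Fin 3) k} (hs : TraceSymmetric T)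
    (hi : IsIdempotentElem T) (h1 : T 1 = 1) (ht : LinearMap.trace k _ T = 3)
    (hc : (matrixFrobenius k 3).conv T T = T) (X Y : Matrix (Fin 3) (Fin 3) k) :
    T (T X * T Y) = T X * T Y := by
  obtain ⟨a, b, ha, hb, hta, htb, haa, hbb, hab, hT⟩ := hs.exists_eq_of_trace_eq_three hi h1 ht
  have hba : (b * a).trace = 0 := by rw [Matrix.trace_mul_comm, hab]
  -- This is `T * T = T` expanded in rank-one maps; `2 / 3` collects the two cross terms with the
  -- unit.
  have hconv : ∀ X : Matrix (Fin 3) (Fin 3) k,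
      (9 : k)⁻¹ • X.trace • (1 : Matrix (Fin 3) (Fin 3) k) +
        (2 / 3 : k) • ((X * a).trace • a + (X * b).trace • b) +
        (X * (a * a)).trace • (a * a) + (X * (b * b)).trace • (b * b) +
        (X * (b * a)).trace • (a * b) + (X * (a * b)).trace • (b * a) =
      (3 : k)⁻¹ • X.trace • (1 : Matrix (Fin 3) (Fin 3) k) + (X * a).trace • a +
        (X * b).trace • b := by
    intro X
    have hadd₁ : ∀ A B C, (matrixFrobenius k 3).conv (A + B) C =
        (matrixFrobenius k 3).conv A C + (matrixFrobenius k 3).conv B C := by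
      intro A B C
      simp [FrobeniusStructure.conv, TensorProduct.map_add_left, LinearMap.comp_add,
        LinearMap.add_comp]
    have hadd₂ : ∀ A B C, (matrixFrobenius k 3).conv C (A + B) =
        (matrixFrobenius k 3).conv C A + (matrixFrobenius k 3).conv C B := by
      intro A B C
      simp [FrobeniusStructure.conv, TensorProduct.map_add_right, LinearMap.comp_add,
        LinearMap.add_comp]
    have hsmul₁ : ∀ (c : k) A C, (matrixFrobenius k 3).conv (c • A) C =
        c • (matrixFrobenius k 3).conv A C := by
      intro c A C
      simp [FrobeniusStructure.conv, TensorProduct.map_smul_left, LinearMap.comp_smul,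
        LinearMap.smul_comp]
    have hsmul₂ : ∀ (c : k) A C, (matrixFrobenius k 3).conv C (c • A) =
        c • (matrixFrobenius k 3).conv C A := by
      intro c A C
      simp [FrobeniusStructure.conv, TensorProduct.map_smul_right, LinearMap.comp_smul,
        LinearMap.smul_comp]
    have h := LinearMap.congr_fun hc X
    rw [hT] at h
    simp only [hadd₁, hadd₂, hsmul₁, hsmul₂, conv_traceRankOne, LinearMap.add_apply,
      LinearMap.smul_apply, traceRankOne_apply, mul_one, one_mul, Nat.cast_ofNat] at h
    rw [← h]
    module
  have hsq : a * a + b * b = (2 / 3 : k) • (1 : Matrix (Fin 3) (Fin 3) k) := by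
    have h := hconv 1
    simp only [one_mul, hta, htb, haa, hbb, hab, hba, Matrix.trace_one, Fintype.card_fin,
      Nat.cast_ofNat] at h
    linear_combination (norm := module) h
  have hbsq : b * b = (2 / 3 : k) • (1 : Matrix (Fin 3) (Fin 3) k) - a * a :=
    eq_sub_of_add_eq' hsq
  -- After eliminating `b * b` the unit terms cancel, and the quadratic tensor is diagonalized by `a
  -- * a - 1 / 3`, the anticommutator and the commutator.
  have key := hs.apply_eq_self_of_tensor_eq ha hb haa hbb hab
    ![a * a - (3 : k)⁻¹ • 1, a * b + b * a, a * b - b * a] ![2, 1 / 2, - 1 / 2]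
    (by intro i; fin_cases i <;> norm_num) (r := (3 : k)⁻¹) (by norm_num) (by
      intro X
      have h := hconv X
      simp only [hbsq, Matrix.mul_sub, Matrix.mul_add, Matrix.trace_sub, Matrix.trace_add,
        Matrix.mul_smul, mul_one, Matrix.trace_smul, smul_eq_mul, Fin.sum_univ_three,
        Matrix.cons_val] at h ⊢
      rw [← sub_eq_zero] at h ⊢
      rw [← h]
      module)
  have k₀ := key 0
  have k₁ := key 1
  have k₂ := key 2
  simp only [Matrix.cons_val, map_sub, map_add, map_smul, h1] at k₀ k₁ k₂
  have kaa : T (a * a) = a * a := sub_left_injective k₀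
  have kbb : T (b * b) = b * b := by rw [hbsq, map_sub, map_smul, h1, kaa]
  have kab : T (a * b) = a * b := by
    linear_combination (norm := module) (2 : k)⁻¹ • k₁ + (2 : k)⁻¹ • k₂
  have kba : T (b * a) = b * a := by
    linear_combination (norm := module) (2 : k)⁻¹ • k₁ - (2 : k)⁻¹ • k₂
  have hTX : ∀ X, T X = (3 : k)⁻¹ • X.trace • (1 : Matrix (Fin 3) (Fin 3) k) +
      (X * a).trace • a + (X * b).trace • b := by
    intro X
    conv_lhs => rw [hT]
    simp
  rw [hTX X, hTX Y]
  simp only [add_mul, mul_add, Matrix.smul_mul, Matrix.mul_smul, one_mul, mul_one, map_add,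
    map_smul, h1, ha, hb, kaa, kab, kba, kbb]

end SmallRank

theorem proposition3p7 (n : ℕ) (hn : n ≤ 3)
    (T : Matrix (Fin n) (Fin n) ℂ →ₗ[ℂ] Matrix (Fin n) (Fin n) ℂ)
    (hT : (matrixFrobenius ℂ n).IsBiprojection T) :
    ExchangeRelations T := by
  rcases Nat.eq_zero_or_pos n with rfl | hpos
  · rw [exchangeRelations_iff]
    exact fun X Y => ⟨Subsingleton.elim _ _, Subsingleton.elim _ _⟩
  have : NeZero n := ⟨hpos.ne'⟩
  obtain ⟨hd, hu, hi, c, hc0, hc⟩ := hT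
  have hs := traceSymmetric_of_dual_eq T hd
  have h1 : T 1 = 1 := by simpa using LinearMap.congr_fun hu 1
  replace hi : IsIdempotentElem T := hi
  refine hs.exchangeRelations ?_
  obtain ⟨d, hdvd, ht⟩ := hs.exists_trace_eq_natCast_dvd_sq hi h1 hc0 hc
  -- The divisors of `1`, `4` and `9`.
  have hcases : d = 1 ∨ d = n ^ 2 ∨ (n = 2 ∧ d = 2) ∨ (n = 3 ∧ d = 3) := by
    have hle := Nat.le_of_dvd (by positivity) hdvd
    interval_cases n <;> interval_cases d <;> revert hdvd <;> decide
  rcases hcases with rfl | rfl | ⟨rfl, rfl⟩ | ⟨rfl, rfl⟩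
  · have h := hs.eq_of_trace_eq_one hi h1 (by simpa using ht)
    have hTX : ∀ X, T X = ((n : ℂ)⁻¹ * X.trace) • 1 := by
      intro X
      conv_lhs => rw [h]
      simp [smul_smul]
    intro X Y
    rw [hTX X, hTX Y]
    simp [h1]
  · simp [eq_id_of_trace_eq_sq hi (by simpa using ht)]
  · obtain ⟨a, ha, hta, h⟩ := hs.exists_eq_of_trace_eq_two hi h1 (by simpa using ht)
    have hTX : ∀ X, T X = (2 : ℂ)⁻¹ • X.trace • (1 : Matrix (Fin 2) (Fin 2) ℂ) +
        (X * a).trace • a := by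
      intro X
      conv_lhs => rw [h]
      simp
    intro X Y
    rw [hTX X, hTX Y]
    simp only [add_mul, mul_add, Matrix.smul_mul, Matrix.mul_smul, one_mul, mul_one, map_add,
      map_smul, h1, ha, mul_self_eq_of_trace_eq_zero hta]
  · have htr := hs.trace_eq_mul_of_conv_self hi h1 hc
    -- The rank `3` equals `n c = 3 c`.
    have hc1 : c = 1 := by
      rw [ht] at htr
      push_cast at htr
      linear_combination -htr / 3
    rw [hc1, one_smul] at hc
    exact hs.mul_mem_of_trace_eq_three hi h1 (by simpa using ht) hc
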